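/- Hypergeometric functions: for lower parameters that are not in $\{0,-1,-2,\dots\}$, ${}_2F_1(a,b;c;z)$ and ${}_3F_2(a_1,a_2,a_3;b_1,b_2;z)$ denote the principal branches of the analytic continuations of $$\sum_{n\ge 0}\frac{(a)_n(b)_n}{(c)_n}\frac{z^n}{n!},\qquad \sum_{n\ge 0}\frac{(a_1)_n(a_2)_n(a_3)_n}{(b_1)_n(b_2)_n}\frac{z^n}{n!}$$ to $\mathbb C\setminus[1,\infty)$ (continuation along the segment $[0,z]$); at a point $x$ of the cut, $x>1$, the value is the limit from below, $\lim_{\varepsilon\downarrow 0}F(x-i\varepsilon)$. Let $k\in\mathbb C$ with $\operatorname{Re}k>-1$ and $k\notin\{0,2,4,6,\dots\}$, and let $y>0$ be real with $y\neq 1$. Put $$L(k,y)=\frac{4}{(k+2)(y-y^{-1})^2}\,{}_3F_2\Big(\tfrac12,1,1;-\tfrac k2,2+\tfrac k2;-\tfrac{4}{(y-y^{-1})^2}\Big),$$ $$T(k,y)=\frac{2y^{-1}}{y^{-1}-y}\Big\{\frac1k\big[{}_2F_1(1,k;k+1;y^{-1})+{}_2F_1(1,k;k+1;-y^{-1})\big]-\frac1{k+2}\big[{}_2F_1(1,k+2;k+3;y^{-1})+{}_2F_1(1,k+2;k+3;-y^{-1})\big]\Big\}.$$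 Then $$L(k,y)+L(-k,y)=2\pi\,\big(\min\{y,y^{-1}\}\big)^{k}\Big(i-\cot\frac{\pi k}{2}\Big)+T(k,y)+T(k,y^{-1}).$$ In particular, for $0<y<1$ the first term on the right is $2\pi y^k\,(i-\cot(\pi k/2))$. -/

import Mathlib

open Filter Topology

/-- `F` analytically continues the germ at `0` of `f` along the straight segment `[0, z]`. -/
def IsRadialContinuation (f : ℂ → ℂ) (z : ℂ) (F : ℂ → ℂ) : Prop :=
  AnalyticOnNhd ℂ F (segment ℝ 0 z) ∧ F =ᶠ[𝓝 0] f

open Classical in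
/-- The value at `z` of the analytic continuation of the germ at `0` of `f` along `[0, z]`
(the junk value `0` if there is no such continuation). -/
noncomputable def radialValue (f : ℂ → ℂ) (z : ℂ) : ℂ :=
  if h : ∃ F, IsRadialContinuation f z F then h.choose z else 0

/-- The value does not depend on the continuation that is chosen. -/
theorem radialValue_eq {f F : ℂ → ℂ} {z : ℂ} (hF : IsRadialContinuation f z F) :
    radialValue f z = F z := by
  have h : ∃ F, IsRadialContinuation f z F := ⟨F, hF⟩
  rw [radialValue, dif_pos h]
  exact h.choose_spec.1.eqOn_of_preconnected_of_eventuallyEq hF.1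
    (convex_segment (𝕜 := ℝ) (0 : ℂ) z).isPreconnected (left_mem_segment ℝ 0 z)
    (h.choose_spec.2.trans hF.2.symm) (right_mem_segment ℝ 0 z)

open Classical in
/-- The principal branch, with cut `[1, ∞)`, of the function whose germ at `0` is that of `f`:
off the cut it is the analytic continuation along the segment `[0, z]`, and at a point `x ≥ 1` of
the cut it is the limit of the values at `x - i ε` as `ε` decreases to `0`. -/
noncomputable def principalBranch (f : ℂ → ℂ) (z : ℂ) : ℂ :=
  if z.im = 0 ∧ 1 ≤ z.re then
    limUnder (𝓝[>] (0 : ℝ)) (fun ε : ℝ => radialValue f (z - Complex.I * (ε : ℂ)))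
  else radialValue f z

/-- The (principal branch of the) Gauss hypergeometric function `₂F₁(a, b; c; z)`. -/
noncomputable def hyp2F1 (a b c z : ℂ) : ℂ :=
  principalBranch (ordinaryHypergeometric a b c) z

/-- The hypergeometric series
`∑ (a₁)ₙ (a₂)ₙ (a₃)ₙ / ((b₁)ₙ (b₂)ₙ) zⁿ / n!`, with `(a)ₙ` the rising factorial. -/
noncomputable def hyp3F2Series (a₁ a₂ a₃ b₁ b₂ z : ℂ) : ℂ :=
  ∑' n : ℕ, (ascPochhammer ℂ n).eval a₁ * (ascPochhammer ℂ n).eval a₂ *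
    (ascPochhammer ℂ n).eval a₃ /
      ((ascPochhammer ℂ n).eval b₁ * (ascPochhammer ℂ n).eval b₂) * (z ^ n / (n.factorial : ℂ))

/-- The (principal branch of the) generalized hypergeometric function `₃F₂`. -/
noncomputable def hyp3F2 (a₁ a₂ a₃ b₁ b₂ z : ℂ) : ℂ :=
  principalBranch (hyp3F2Series a₁ a₂ a₃ b₁ b₂) z

/-- The term `4 / ((k + 2) (y - y⁻¹)²) · ₃F₂(1/2, 1, 1; -k/2, 2 + k/2; -4 / (y - y⁻¹)²)`. -/
noncomputable def threeFTwoTerm (k y : ℂ) : ℂ :=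
  4 / ((k + 2) * (y - y⁻¹) ^ 2) *
    hyp3F2 (1 / 2) 1 1 (-k / 2) (2 + k / 2) (-4 / (y - y⁻¹) ^ 2)

/-- The term with the four Gauss functions at `± y⁻¹`. -/
noncomputable def twoFOneTerm (k y : ℂ) : ℂ :=
  2 * y⁻¹ / (y⁻¹ - y) *
    (1 / k * (hyp2F1 1 k (k + 1) y⁻¹ + hyp2F1 1 k (k + 1) (-y⁻¹)) -
      1 / (k + 2) * (hyp2F1 1 (k + 2) (k + 3) y⁻¹ + hyp2F1 1 (k + 2) (k + 3) (-y⁻¹)))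

/-! Every function involved reduces to the Lerch functions `E_a(x) = ∑ xⁿ / (n + a)`, characterised
on the plane cut along `[1, ∞)` by `x E' + a E = 1 / (1 - x)` (`IsLerch`). Let `A` and `B` be those
of parameters `1 - k/2` and `1 + k/2`. For `0 < y < 1` both sides of the identity equal `2 y² (A(y²)
+ B(y²))`; the case `y > 1` follows by the symmetry `y ↔ y⁻¹`.

Left side: substitute `z = -4q / (1 - q)²` and put `V = 2q (A(q) + B(q))`. As a function of `z`, `V`
satisfies a second-order equation (`ode_koebeSum`), which amounts to a two-term recurrence for its
Taylor coefficients. Hence `₃F₂` is an explicit combination of `V / z`, `V'` and a constant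
(`hyp3F2_eq`). The prefactor of `L` is `-z / (k + 2)`, and `V` is even in `k`. In `L(k) + L(-k)`
everything odd in `k` cancels and `V` remains; at the given argument `q = y²`.

Right side: `₂F₁(1, a; a+1; x) = a E_a(x)`. At `± y`, `E_a(y) + E_a(-y) = E_{a/2}(y²)`. At `± y⁻¹`
the inversion formula (`inversion`) brings the argument back to `y²`, at the cost of a multiple of
`π / sin(πa/2)`. Its limit from below the cut produces `π yᵃ (cot(πa/2) - i)`, exactly what the
explicit term of the identity cancels. The constant in the inversion formula comes from `E_α(-1) +
E_{1-α}(-1) = π / sin(πα)`, a partial fraction expansion. -/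

/-- The `n`-th Taylor coefficient of `f` at `0`. -/
noncomputable def taylorCoeff (f : ℂ → ℂ) (n : ℕ) : ℂ :=
  iteratedDeriv n f 0 / (n.factorial : ℂ)

/-! ### Calculus of Taylor coefficients at the origin. -/

namespace taylorCoeff

variable {f g : ℂ → ℂ}

theorem zero_eq (f : ℂ → ℂ) : taylorCoeff f 0 = f 0 := by
  simp [taylorCoeff]

theorem congr (h : f =ᶠ[𝓝 0] g) (n : ℕ) : taylorCoeff f n = taylorCoeff g n := by
  rw [taylorCoeff, taylorCoeff, h.iteratedDeriv_eq]

theorem add (hf : AnalyticAt ℂ f 0) (hg : AnalyticAt ℂ g 0) (n : ℕ) :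
    taylorCoeff (fun z => f z + g z) n = taylorCoeff f n + taylorCoeff g n := by
  rw [taylorCoeff, iteratedDeriv_fun_add hf.contDiffAt hg.contDiffAt, add_div]
  rfl

theorem const_mul (c : ℂ) (f : ℂ → ℂ) (n : ℕ) :
    taylorCoeff (fun z => c * f z) n = c * taylorCoeff f n := by
  rw [taylorCoeff, iteratedDeriv_const_mul_field, mul_div_assoc]
  rfl

theorem sub (hf : AnalyticAt ℂ f 0) (hg : AnalyticAt ℂ g 0) (n : ℕ) :
    taylorCoeff (fun z => f z - g z) n = taylorCoeff f n - taylorCoeff g n := by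
  have h := add hf (analyticAt_const.mul hg (f := fun _ => (-1 : ℂ))) n
  have h2 := const_mul (-1) g n
  simp only [Pi.mul_apply, Pi.mul_def] at h
  rw [h2] at h
  rw [sub_eq_add_neg, ← neg_one_mul, ← h]
  congr 1
  funext z
  ring

theorem const (c : ℂ) (n : ℕ) : taylorCoeff (fun _ => c) n = if n = 0 then c else 0 := by
  rw [taylorCoeff, iteratedDeriv_const]
  split_ifs with h
  · simp [h]
  · simp

theorem deriv_eq (f : ℂ → ℂ) (n : ℕ) :
    taylorCoeff (deriv f) n = (n + 1) * taylorCoeff f (n + 1) := by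
  have h : ((n.factorial : ℕ) : ℂ) ≠ 0 := by exact_mod_cast n.factorial_ne_zero
  have h' : (n : ℂ) + 1 ≠ 0 := by exact_mod_cast n.succ_ne_zero
  rw [taylorCoeff, taylorCoeff, iteratedDeriv_succ', Nat.factorial_succ]
  push_cast
  field_simp

theorem id_mul_succ (hf : AnalyticAt ℂ f 0) (n : ℕ) :
    taylorCoeff (fun z => z * f z) (n + 1) = taylorCoeff f n := by
  -- Coefficients of `(z g)' = g + z g'`; the last term is again of the form `z * _`, so induction
  -- on the order closes the loop.
  have key : ∀ m, ∀ g : ℂ → ℂ, AnalyticAt ℂ g 0 →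
      (m + 1) * taylorCoeff (fun z => z * g z) (m + 1) =
        taylorCoeff g m + taylorCoeff (fun z => z * deriv g z) m := by
    intro m g hg
    have hz : AnalyticAt ℂ (fun z => z * deriv g z) 0 := analyticAt_id.mul hg.deriv
    rw [← deriv_eq, ← add hg hz]
    apply congr
    filter_upwards [hg.eventually_analyticAt] with z hz
    have h : HasDerivAt (fun z => z * g z) (1 * g z + z * deriv g z) z :=
      (hasDerivAt_id z).mul hz.differentiableAt.hasDerivAt
    rw [h.deriv, one_mul]
  induction n generalizing f with
  | zero => simpa [zero_eq] using key 0 f hf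
  | succ n ih =>
    have h := key (n + 1) f hf
    rw [ih hf.deriv, deriv_eq] at h
    have h' : (n : ℂ) + 1 + 1 ≠ 0 := by exact_mod_cast (n + 1).succ_ne_zero
    push_cast at h
    apply mul_left_cancel₀ h'
    rw [h]
    ring

theorem id_mul_deriv (hf : AnalyticAt ℂ f 0) (n : ℕ) :
    taylorCoeff (fun z => z * deriv f z) n = n * taylorCoeff f n := by
  cases n with
  | zero => simp [zero_eq]
  | succ n => rw [id_mul_succ hf.deriv, deriv_eq]; push_cast; rfl

theorem hasSum_of_ball {r : ℝ} (hf : DifferentiableOn ℂ f (Metric.ball 0 r)) {z : ℂ}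
    (hz : z ∈ Metric.ball (0 : ℂ) r) : HasSum (fun n => taylorCoeff f n * z ^ n) (f z) := by
  have h : (fun n => taylorCoeff f n * z ^ n) =
      fun n : ℕ => (n.factorial : ℂ)⁻¹ • (z - 0) ^ n • iteratedDeriv n f 0 := by
    funext n
    simp only [taylorCoeff, sub_zero, smul_eq_mul]
    ring
  rw [h]
  exact Complex.hasSum_taylorSeries_on_ball hf hz

theorem eventually_hasSum (hf : AnalyticAt ℂ f 0) :
    ∀ᶠ z in 𝓝 (0 : ℂ), HasSum (fun n => taylorCoeff f n * z ^ n) (f z) := by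
  obtain ⟨r, hr, hf⟩ := Metric.eventually_nhds_iff_ball.1 hf.eventually_analyticAt
  filter_upwards [Metric.ball_mem_nhds (0 : ℂ) hr] with z hz
  exact hasSum_of_ball (fun w hw => (hf w hw).differentiableAt.differentiableWithinAt) hz

end taylorCoeff

/-! ### The cut plane, star-shaped about the origin. -/

/-- The complex plane cut along `[1, ∞)`. -/
def cutPlane : Set ℂ := {x | 1 - x ∈ Complex.slitPlane}

namespace cutPlane

theorem isOpen : IsOpen cutPlane :=
  Complex.isOpen_slitPlane.preimage (continuous_const.sub continuous_id)

theorem mem_iff {x : ℂ} : x ∈ cutPlane ↔ x.re < 1 ∨ x.im ≠ 0 := by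
  simp [cutPlane, Complex.mem_slitPlane_iff]

theorem zero_mem : (0 : ℂ) ∈ cutPlane := by simp [mem_iff]

theorem mem_nhds_zero : cutPlane ∈ 𝓝 (0 : ℂ) := isOpen.mem_nhds zero_mem

theorem one_sub_ne_zero {x : ℂ} (hx : x ∈ cutPlane) : 1 - x ≠ 0 :=
  Complex.slitPlane_ne_zero hx

theorem mul_ofReal_mem {x : ℂ} (hx : x ∈ cutPlane) {t : ℝ} (h0 : 0 ≤ t) (h1 : t ≤ 1) :
    x * t ∈ cutPlane := by
  rw [mem_iff] at hx ⊢
  rcases h0.eq_or_lt with rfl | h0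
  · simp
  simp only [Complex.mul_re, Complex.ofReal_re, Complex.ofReal_im, mul_zero, sub_zero,
    Complex.mul_im, zero_add]
  rcases hx with hx | hx
  · left
    nlinarith
  · right
    simpa [h0.ne'] using hx

theorem segment_subset {x : ℂ} (hx : x ∈ cutPlane) : segment ℝ 0 x ⊆ cutPlane := by
  intro w hw
  rw [segment_eq_image'] at hw
  obtain ⟨t, ht, rfl⟩ := hw
  have := mul_ofReal_mem hx ht.1 ht.2
  simpa [mul_comm] using this

theorem isPreconnected : IsPreconnected cutPlane := by
  have h : StarConvex ℝ (0 : ℂ) cutPlane :=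
    starConvex_iff_segment_subset.2 fun y hy => segment_subset hy
  exact (h.isPathConnected zero_mem).isConnected.isPreconnected

theorem ball_subset : Metric.ball (0 : ℂ) 1 ⊆ cutPlane := by
  intro x hx
  rw [mem_iff]
  left
  have := Complex.re_le_norm x
  simp at hx
  linarith

end cutPlane

/-! ### Lerch functions: uniqueness and existence. -/

/-- `E` is the analytic function on the cut plane with Taylor series `∑ xⁿ / (n + a)`, described
by the differential equation `x E' + a E = 1 / (1 - x)`. -/
structure IsLerch (a : ℂ) (E : ℂ → ℂ) : Prop where
  differentiableOn : DifferentiableOn ℂ E cutPlane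
  ode : ∀ x ∈ cutPlane, x * deriv E x + a * E x = (1 - x)⁻¹

namespace IsLerch

variable {a : ℂ} {E E' : ℂ → ℂ}

theorem analyticOnNhd (h : IsLerch a E) : AnalyticOnNhd ℂ E cutPlane :=
  h.differentiableOn.analyticOnNhd cutPlane.isOpen

theorem analyticAt (h : IsLerch a E) {x : ℂ} (hx : x ∈ cutPlane) : AnalyticAt ℂ E x :=
  h.analyticOnNhd x hx

theorem hasDerivAt (h : IsLerch a E) {x : ℂ} (hx : x ∈ cutPlane) :
    HasDerivAt E (deriv E x) x :=
  (h.analyticAt hx).differentiableAt.hasDerivAt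

theorem _root_.taylorCoeff.inv_one_sub (n : ℕ) :
    taylorCoeff (fun x : ℂ => (1 - x)⁻¹) n = 1 := by
  have ha : AnalyticAt ℂ (fun x : ℂ => (1 - x)⁻¹) 0 :=
    (analyticAt_const.sub analyticAt_id).inv (by simp)
  cases n with
  | zero => simp [taylorCoeff.zero_eq]
  | succ n =>
    have hz : AnalyticAt ℂ (fun x : ℂ => x * (1 - x)⁻¹) 0 := analyticAt_id.mul ha
    have h : taylorCoeff (fun x : ℂ => (1 - x)⁻¹ - x * (1 - x)⁻¹) (n + 1) =
        taylorCoeff (fun _ => 1) (n + 1) := by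
      apply taylorCoeff.congr
      filter_upwards [cutPlane.mem_nhds_zero] with x hx
      have := cutPlane.one_sub_ne_zero hx
      field_simp
    rw [taylorCoeff.sub ha hz, taylorCoeff.id_mul_succ ha, taylorCoeff.const] at h
    rw [if_neg n.succ_ne_zero, sub_eq_zero] at h
    rw [h, taylorCoeff.inv_one_sub n]

/-- Comparing coefficients in the differential equation gives `(n + a) cₙ = 1`. No initial condition
is needed, since analyticity at the singular point `0` already singles out one solution. -/
theorem taylorCoeff_eq (h : IsLerch a E) (ha : ∀ n : ℕ, a ≠ -n) (n : ℕ) :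
    taylorCoeff E n = 1 / (n + a) := by
  have hE := h.analyticAt cutPlane.zero_mem
  have hz : AnalyticAt ℂ (fun x => x * deriv E x) 0 := analyticAt_id.mul hE.deriv
  have hc : AnalyticAt ℂ (fun x => a * E x) 0 := analyticAt_const.mul hE
  have h1 : taylorCoeff (fun x => x * deriv E x + a * E x) n = 1 := by
    rw [← taylorCoeff.inv_one_sub n]
    apply taylorCoeff.congr
    filter_upwards [cutPlane.mem_nhds_zero] with x hx
    exact h.ode x hx
  rw [taylorCoeff.add hz hc, taylorCoeff.const_mul, taylorCoeff.id_mul_deriv hE] at h1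
  have h3 : (n : ℂ) + a ≠ 0 := fun h0 => ha n (by linear_combination h0)
  field_simp
  linear_combination h1

theorem hasSum (h : IsLerch a E) (ha : ∀ n : ℕ, a ≠ -n) {x : ℂ} (hx : ‖x‖ < 1) :
    HasSum (fun n : ℕ => x ^ n / (n + a)) (E x) := by
  have := taylorCoeff.hasSum_of_ball (h.differentiableOn.mono cutPlane.ball_subset)
    (z := x) (by simpa using hx)
  simpa [h.taylorCoeff_eq ha, div_eq_inv_mul] using this

theorem eqOn (h : IsLerch a E) (h' : IsLerch a E') (ha : ∀ n : ℕ, a ≠ -n) :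
    Set.EqOn E E' cutPlane := by
  apply h.analyticOnNhd.eqOn_of_preconnected_of_eventuallyEq h'.analyticOnNhd
    cutPlane.isPreconnected cutPlane.zero_mem
  filter_upwards [Metric.ball_mem_nhds (0 : ℂ) one_pos] with x hx
  have hx : ‖x‖ < 1 := by simpa using hx
  exact (h.hasSum ha hx).unique (h'.hasSum ha hx)

/-- Splitting off the term `n = 0` of `∑ xⁿ / (n + a)` shifts the parameter by one. -/
theorem of_succ (h : IsLerch (a + 1) E) (ha : a ≠ 0) : IsLerch a (fun x => 1 / a + x * E x) := by
  refine ⟨(differentiableOn_const _).add (differentiableOn_id.mul h.differentiableOn), ?_⟩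
  intro x hx
  have hd : HasDerivAt (fun x => 1 / a + x * E x) (1 * E x + x * deriv E x) x :=
    ((hasDerivAt_id x).mul (h.hasDerivAt hx)).const_add (1 / a)
  have ho := h.ode x hx
  have h1 := cutPlane.one_sub_ne_zero hx
  have h2 : x * (1 * E x + x * deriv E x) + a * (1 / a + x * E x) =
      1 + x * (x * deriv E x + (a + 1) * E x) := by
    field_simp
    ring
  rw [hd.deriv, h2, ho]
  field_simp
  ring

/-- The Euler integral for `∑ xⁿ / (n + a)`. -/
theorem integral (ha : 1 < a.re) :
    IsLerch a (fun x => ∫ t in (0 : ℝ)..1, (t : ℂ) ^ (a - 1) * (1 - x * t)⁻¹) := by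
  have hne : ∀ {x : ℂ} {t : ℝ}, x ∈ cutPlane → 0 ≤ t → t ≤ 1 → 1 - x * t ≠ 0 :=
    fun hx h0 h1 => cutPlane.one_sub_ne_zero (cutPlane.mul_ofReal_mem hx h0 h1)
  -- Asking for `1 < a.re` rather than `0 < a.re` makes the integrand continuous at `t = 0`; smaller
  -- real parts are reached by `of_succ`.
  have hpow : Continuous fun t : ℝ => (t : ℂ) ^ (a - 1) :=
    Complex.continuous_ofReal_cpow_const (by simpa using ha)
  have ha0 : a ≠ 0 := by rintro rfl; simp at ha; linarith
  have hF : ∀ {x}, x ∈ cutPlane →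
      ContinuousOn (fun t : ℝ => (t : ℂ) ^ (a - 1) * (1 - x * t)⁻¹) (Set.Icc 0 1) := fun hx =>
    hpow.continuousOn.mul (ContinuousOn.inv₀ (by fun_prop) fun t ht => hne hx ht.1 ht.2)
  have hF' : ∀ {K : Set ℂ}, K ⊆ cutPlane → ContinuousOn
      (fun p : ℂ × ℝ => (p.2 : ℂ) ^ (a - 1) * (p.2 * ((1 - p.1 * p.2)⁻¹) ^ 2))
      (K ×ˢ Set.Icc 0 1) := fun hK =>
    (hpow.comp continuous_snd).continuousOn.mul <| ContinuousOn.mul (by fun_prop) <|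
      (ContinuousOn.inv₀ (by fun_prop) fun p hp => hne (hK hp.1) hp.2.1 hp.2.2).pow 2
  have hF1 : ∀ {x}, x ∈ cutPlane → ContinuousOn
      (fun t : ℝ => (t : ℂ) ^ (a - 1) * (t * ((1 - x * t)⁻¹) ^ 2)) (Set.Icc 0 1) := fun {x} hx =>
    (hF' (Set.singleton_subset_iff.2 hx)).comp
      (f := fun t : ℝ => (x, t)) (by fun_prop) (fun t ht => ⟨rfl, ht⟩)
  have hder : ∀ x ∈ cutPlane, HasDerivAt
      (fun x : ℂ => ∫ t in (0 : ℝ)..1, (t : ℂ) ^ (a - 1) * (1 - x * t)⁻¹)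
      (∫ t in (0 : ℝ)..1, (t : ℂ) ^ (a - 1) * (t * ((1 - x * t)⁻¹) ^ 2)) x := by
    intro x hx
    obtain ⟨r, hr, hball⟩ := Metric.nhds_basis_closedBall.mem_iff.1 (cutPlane.isOpen.mem_nhds hx)
    obtain ⟨C, hC⟩ := ((isCompact_closedBall x r).prod
      (isCompact_Icc (a := (0 : ℝ)) (b := 1))).exists_bound_of_continuousOn (hF' hball)
    have hsub : Set.uIoc (0 : ℝ) 1 ⊆ Set.Icc 0 1 := by
      rw [Set.uIoc_of_le zero_le_one]
      exact Set.Ioc_subset_Icc_self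
    have hmeas : ∀ {f : ℝ → ℂ}, ContinuousOn f (Set.Icc 0 1) →
        MeasureTheory.AEStronglyMeasurable f
          (MeasureTheory.volume.restrict (Set.uIoc (0 : ℝ) 1)) := fun hf =>
      (hf.mono hsub).aestronglyMeasurable measurableSet_uIoc
    refine (intervalIntegral.hasDerivAt_integral_of_dominated_loc_of_deriv_le
      (bound := fun _ => C)
      (F' := fun (x : ℂ) (t : ℝ) => (t : ℂ) ^ (a - 1) * (t * ((1 - x * t)⁻¹) ^ 2))
      (Metric.closedBall_mem_nhds x hr) ?_ ?_ (hmeas (hF1 hx)) ?_ ?_ ?_).2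
    · filter_upwards [cutPlane.isOpen.mem_nhds hx] with w hw using hmeas (hF hw)
    · exact (hF hx).intervalIntegrable_of_Icc zero_le_one
    · exact Eventually.of_forall fun t ht w hw => hC (w, t) ⟨hw, hsub ht⟩
    · exact intervalIntegrable_const
    · refine Eventually.of_forall fun t ht w hw => ?_
      have h0 := hne (hball hw) (hsub ht).1 (hsub ht).2
      refine (((((hasDerivAt_id w).mul_const (t : ℂ)).const_sub 1).inv h0).const_mul
        ((t : ℂ) ^ (a - 1))).congr_deriv ?_
      simp only [id_eq]
      field_simp
  refine ⟨fun x hx => (hder x hx).differentiableAt.differentiableWithinAt, fun x hx => ?_⟩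
  rw [(hder x hx).deriv]
  have hi1 := (hF hx).intervalIntegrable_of_Icc (μ := MeasureTheory.volume) zero_le_one
  have hi2 := (hF1 hx).intervalIntegrable_of_Icc (μ := MeasureTheory.volume) zero_le_one
  -- The integrand of `x E' + a E` is the `t`-derivative of `tᵃ / (1 - x t)`, so only the boundary
  -- value at `t = 1` survives.
  rw [← intervalIntegral.integral_const_mul, ← intervalIntegral.integral_const_mul,
    ← intervalIntegral.integral_add (hi2.const_mul x) (hi1.const_mul a),
    intervalIntegral.integral_eq_sub_of_hasDerivAt_of_le
      (f := fun t : ℝ => (t : ℂ) ^ a * (1 - x * t)⁻¹) zero_le_one]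
  · simp [ha0]
  · exact ((Complex.continuous_ofReal_cpow_const (by linarith)).continuousOn).mul
      (ContinuousOn.inv₀ (by fun_prop) fun t ht => hne hx ht.1 ht.2)
  · intro t ht
    have ht0 : (t : ℂ) ≠ 0 := by exact_mod_cast ht.1.ne'
    have h0 := hne hx ht.1.le ht.2.le
    have h1 : HasDerivAt (fun s : ℝ => (s : ℂ) ^ a) (a * (t : ℂ) ^ (a - 1)) t := by
      have := (hasDerivAt_id (t : ℂ)).cpow_const (c := a)
        (Complex.ofReal_mem_slitPlane.2 ht.1)
      simpa using this.comp_ofReal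
    have h2 : HasDerivAt (fun s : ℝ => (1 - x * s)⁻¹) (-(-x) / (1 - x * t) ^ 2) t := by
      have := (((hasDerivAt_id (t : ℂ)).const_mul x).const_sub 1).inv h0
      simpa using this.comp_ofReal
    refine (h1.mul h2).congr_deriv ?_
    rw [Complex.cpow_sub _ _ ht0, Complex.cpow_one]
    field_simp
    ring
  · exact (hi2.const_mul x).add (hi1.const_mul a)

theorem exists_of_ne (ha : ∀ n : ℕ, a ≠ -n) : ∃ E, IsLerch a E := by
  obtain ⟨N, hN⟩ := exists_nat_gt (1 - a.re)
  induction N generalizing a with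
  | zero => exact ⟨_, integral (by simp at hN; linarith)⟩
  | succ N ih =>
    obtain ⟨E, hE⟩ := ih (a := a + 1) (fun n h => ha (n + 1) (by push_cast; linear_combination h))
      (by push_cast at hN; simp; linarith)
    exact ⟨_, hE.of_succ (by simpa using ha 0)⟩

end IsLerch

/-! ### Principal branches read off from a function analytic on the cut plane. -/

section PrincipalBranch

variable {f F : ℂ → ℂ}

theorem radialValue_of_mem_cutPlane (hF : AnalyticOnNhd ℂ F cutPlane) (h : F =ᶠ[𝓝 0] f) {z : ℂ}
    (hz : z ∈ cutPlane) : radialValue f z = F z :=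
  radialValue_eq ⟨hF.mono (cutPlane.segment_subset hz), h⟩

theorem principalBranch_of_mem_cutPlane (hF : AnalyticOnNhd ℂ F cutPlane) (h : F =ᶠ[𝓝 0] f)
    {z : ℂ} (hz : z ∈ cutPlane) : principalBranch f z = F z := by
  rw [principalBranch, if_neg, radialValue_of_mem_cutPlane hF h hz]
  rw [cutPlane.mem_iff] at hz
  rintro ⟨h1, h2⟩
  rcases hz with hz | hz
  · linarith
  · exact hz h1

theorem cutPlane.sub_I_mul_mem (x : ℝ) {ε : ℝ} (hε : 0 < ε) :
    (x : ℂ) - Complex.I * (ε : ℂ) ∈ cutPlane := by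
  rw [cutPlane.mem_iff]
  right
  simpa using hε.ne'

theorem principalBranch_of_one_le (hF : AnalyticOnNhd ℂ F cutPlane) (h : F =ᶠ[𝓝 0] f)
    {x : ℝ} (hx : 1 ≤ x) {l : ℂ}
    (hl : Tendsto (fun ε : ℝ => F (x - Complex.I * (ε : ℂ))) (𝓝[>] 0) (𝓝 l)) :
    principalBranch f x = l := by
  rw [principalBranch, if_pos (by simpa using hx)]
  apply Tendsto.limUnder_eq
  apply hl.congr'
  filter_upwards [self_mem_nhdsWithin] with ε hε
  exact (radialValue_of_mem_cutPlane hF h (cutPlane.sub_I_mul_mem x hε)).symm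

end PrincipalBranch

theorem mul_ascPochhammer_eval_add_one (a : ℂ) (n : ℕ) :
    a * (ascPochhammer ℂ n).eval (a + 1) = (ascPochhammer ℂ n).eval a * (a + n) := by
  rw [← ascPochhammer_succ_eval, ascPochhammer_succ_left]
  simp

theorem ascPochhammer_eval_ne_zero {a : ℂ} (ha : ∀ n : ℕ, a ≠ -n) (n : ℕ) :
    (ascPochhammer ℂ n).eval a ≠ 0 := by
  rw [ne_eq, ascPochhammer_eval_eq_zero_iff]
  rintro ⟨m, -, hm⟩
  exact ha m (by rw [hm, neg_neg])

/-! ### Gauss functions as Lerch functions. -/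

namespace IsLerch

variable {a : ℂ} {E : ℂ → ℂ}

/-- The quotient `(a)ₙ / (a + 1)ₙ` telescopes to `a / (a + n)`, and `(1)ₙ` cancels `n!`. -/
theorem eventuallyEq_ordinaryHypergeometric (h : IsLerch a E) (ha : ∀ n : ℕ, a ≠ -n) :
    (fun x => a * E x) =ᶠ[𝓝 0] ordinaryHypergeometric (1 : ℂ) a (a + 1) := by
  filter_upwards [Metric.ball_mem_nhds (0 : ℂ) one_pos] with x hx
  rw [ordinaryHypergeometric_eq_tsum, ← ((h.hasSum ha (by simpa using hx)).mul_left a).tsum_eq]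
  congr 1
  funext n
  have h1 := mul_ascPochhammer_eval_add_one a n
  have h2 : (ascPochhammer ℂ n).eval (a + 1) ≠ 0 := ascPochhammer_eval_ne_zero
    (fun m hm => ha (m + 1) (by push_cast; linear_combination hm)) n
  have h3 : (n : ℂ) + a ≠ 0 := fun h0 => ha n (by linear_combination h0)
  have h4 : ((n.factorial : ℕ) : ℂ) ≠ 0 := by exact_mod_cast n.factorial_ne_zero
  rw [ascPochhammer_eval_one, smul_eq_mul]
  field_simp
  linear_combination x ^ n * h1

theorem analyticOnNhd_const_mul (h : IsLerch a E) (c : ℂ) :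
    AnalyticOnNhd ℂ (fun x => c * E x) cutPlane := fun _ hx =>
  analyticAt_const.mul (h.analyticAt hx)

theorem hyp2F1_of_mem (h : IsLerch a E) (ha : ∀ n : ℕ, a ≠ -n) {z : ℂ} (hz : z ∈ cutPlane) :
    hyp2F1 1 a (a + 1) z = a * E z :=
  principalBranch_of_mem_cutPlane (h.analyticOnNhd_const_mul a)
    (h.eventuallyEq_ordinaryHypergeometric ha) hz

theorem hyp2F1_of_one_le (h : IsLerch a E) (ha : ∀ n : ℕ, a ≠ -n) {x : ℝ} (hx : 1 ≤ x) {l : ℂ}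
    (hl : Tendsto (fun ε : ℝ => E (x - Complex.I * (ε : ℂ))) (𝓝[>] 0) (𝓝 l)) :
    hyp2F1 1 a (a + 1) x = a * l :=
  principalBranch_of_one_le (h.analyticOnNhd_const_mul a)
    (h.eventuallyEq_ordinaryHypergeometric ha) hx (hl.const_mul a)

end IsLerch

/-! ### Partial fractions of the cosecant. -/

theorem Complex.cot_half_sub_cot {x : ℂ} (h : Complex.sin x ≠ 0) :
    Complex.cot (x / 2) - Complex.cot x = 1 / Complex.sin x := by
  have hs : Complex.sin x = 2 * Complex.sin (x / 2) * Complex.cos (x / 2) := by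
    rw [← Complex.sin_two_mul]; congr 1; ring
  have hc : Complex.cos x = 2 * Complex.cos (x / 2) ^ 2 - 1 := by
    rw [← Complex.cos_two_mul]; congr 1; ring
  have h1 : Complex.sin (x / 2) ≠ 0 := by rintro h0; simp [hs, h0] at h
  have h2 : Complex.cos (x / 2) ≠ 0 := by rintro h0; simp [hs, h0] at h
  rw [Complex.cot, Complex.cot, hs, hc]
  field_simp
  ring

open Complex in
theorem Complex.mem_integerComplement_of_ne {α : ℂ} (h : ∀ n : ℤ, α ≠ n) :
    α ∈ integerComplement := by
  rintro ⟨n, hn⟩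
  exact h n hn.symm

/-- The partial fraction expansion of `π / sin (π α)`. -/
theorem hasSum_alternating_cotTerm {α : ℂ} (hα : ∀ n : ℤ, α ≠ n) :
    HasSum (fun n : ℕ => (-1 : ℂ) ^ (n + 1) * cotTerm α n)
      (Real.pi / Complex.sin (Real.pi * α) - 1 / α) := by
  have h1 := Complex.mem_integerComplement_of_ne hα
  have h2 : α / 2 ∈ Complex.integerComplement := Complex.mem_integerComplement_of_ne
    fun n hn => hα (2 * n) (by push_cast; linear_combination 2 * hn)
  have hs := summable_cotTerm h1
  have hs2 := (summable_cotTerm h2).hasSum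
  have he : Summable fun m : ℕ => cotTerm α (2 * m) :=
    hs.comp_injective (mul_right_injective₀ two_ne_zero)
  have ho : Summable fun m : ℕ => cotTerm α (2 * m + 1) :=
    hs.comp_injective ((add_left_injective 1).comp (mul_right_injective₀ two_ne_zero))
  have hsum := tsum_even_add_odd he ho
  have hc1 : ∑' n, cotTerm α n = Real.pi * Complex.cot (Real.pi * α) - 1 / α :=
    (cot_series_rep' h1).symm
  have hc2 : ∑' n, cotTerm (α / 2) n = Real.pi * Complex.cot (Real.pi * (α / 2)) - 1 / (α / 2) :=
    (cot_series_rep' h2).symm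
  -- `cotTerm α n` has its poles at `±(n + 1)`, so odd indices carry the even integers. The
  -- alternating sum is twice the sum over these minus the full sum, that is, `cot` at the half
  -- argument minus `cot`.
  have hterm : ∀ n : ℕ, cotTerm (α / 2) n = 2 * cotTerm α (2 * n + 1) := by
    intro n
    have e1 : α / 2 - (n + 1) = (α - ((2 * n + 1 : ℕ) + 1)) / 2 := by push_cast; ring
    have e2 : α / 2 + (n + 1) = (α + ((2 * n + 1 : ℕ) + 1)) / 2 := by push_cast; ring
    simp only [cotTerm, e1, e2, one_div, inv_div]
    ring
  simp only [hterm, tsum_mul_left] at hc2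
  have hsin := sin_pi_mul_ne_zero h1
  have hcot := Complex.cot_half_sub_cot hsin
  have h0 : α ≠ 0 := by simpa using hα 0
  have := HasSum.even_add_odd (f := fun n : ℕ => (-1 : ℂ) ^ (n + 1) * cotTerm α n)
    (by simpa [pow_succ, pow_mul] using he.hasSum.neg)
    (by simpa [pow_succ, pow_mul] using ho.hasSum)
  convert this using 1
  rw [div_eq_mul_one_div (Real.pi : ℂ), ← hcot, mul_div_assoc]
  have e : 1 / (α / 2) = 2 * (1 / α) := by field_simp
  rw [e] at hc2
  linear_combination -hc2 + hc1 + hsum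

/-! ### Reflection at `-1` and the inversion formula. -/

namespace IsLerch

variable {a α : ℂ} {E G : ℂ → ℂ}

theorem _root_.cutPlane.neg_ofReal_mem {r : ℝ} (hr : 0 ≤ r) : -(r : ℂ) ∈ cutPlane := by
  rw [cutPlane.mem_iff]
  left
  simp
  linarith

/-- An Abel limit `r → 1⁻` along `-r`. Neither series converges absolutely at `-1`, but the factor
`r` in front of `G` aligns the powers, so that the terms pair into `cotTerm α n`, which is
absolutely summable and dominates. -/
theorem add_reflect_neg_one (hα : ∀ n : ℤ, α ≠ n) (hE : IsLerch α E) (hG : IsLerch (1 - α) G) :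
    E (-1) + G (-1) = Real.pi / Complex.sin (Real.pi * α) := by
  have hα1 : ∀ n : ℕ, α ≠ -n := fun n h => hα (-n) (by simpa using h)
  have hα2 : ∀ n : ℕ, 1 - α ≠ -n := fun n h => hα (n + 1) (by push_cast; linear_combination -h)
  have hcont : Tendsto (fun r : ℝ => E (-(r : ℂ)) + r * G (-(r : ℂ))) (𝓝[<] 1)
      (𝓝 (E (-1) + G (-1))) := by
    have hm : -((1 : ℝ) : ℂ) ∈ cutPlane := cutPlane.neg_ofReal_mem zero_le_one
    have h1 : ContinuousAt (fun r : ℝ => E (-(r : ℂ))) 1 :=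
      ContinuousAt.comp (g := E) (f := fun r : ℝ => -(r : ℂ))
        (hE.analyticAt hm).continuousAt (by fun_prop)
    have h2 : ContinuousAt (fun r : ℝ => G (-(r : ℂ))) 1 :=
      ContinuousAt.comp (g := G) (f := fun r : ℝ => -(r : ℂ))
        (hG.analyticAt hm).continuousAt (by fun_prop)
    have h3 : ContinuousAt (fun r : ℝ => E (-(r : ℂ)) + r * G (-(r : ℂ))) 1 :=
      h1.add (ContinuousAt.mul (by fun_prop) h2)
    simpa using h3.tendsto.mono_left nhdsWithin_le_nhds
  have hsum := hasSum_alternating_cotTerm hα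
  have hser : Tendsto (fun r : ℝ => 1 / α + ∑' n : ℕ, (-(r : ℂ)) ^ (n + 1) * cotTerm α n) (𝓝[<] 1)
      (𝓝 (1 / α + ∑' n : ℕ, (-1 : ℂ) ^ (n + 1) * cotTerm α n)) := by
    refine tendsto_const_nhds.add ?_
    apply tendsto_tsum_of_dominated_convergence (bound := fun n => ‖cotTerm α n‖)
    · exact (summable_cotTerm (Complex.mem_integerComplement_of_ne hα)).norm
    · intro n
      have : ContinuousAt (fun r : ℝ => (-(r : ℂ)) ^ (n + 1) * cotTerm α n) 1 := by fun_prop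
      simpa using this.tendsto.mono_left nhdsWithin_le_nhds
    · filter_upwards [Ioo_mem_nhdsLT zero_lt_one] with r hr n
      rw [norm_mul, norm_pow, norm_neg, Complex.norm_of_nonneg hr.1.le]
      exact mul_le_of_le_one_left (norm_nonneg _) (pow_le_one₀ hr.1.le hr.2.le)
  have heq : (fun r : ℝ => E (-(r : ℂ)) + r * G (-(r : ℂ))) =ᶠ[𝓝[<] 1]
      fun r : ℝ => 1 / α + ∑' n : ℕ, (-(r : ℂ)) ^ (n + 1) * cotTerm α n := by
    filter_upwards [Ioo_mem_nhdsLT zero_lt_one] with r hr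
    have hr1 : ‖-(r : ℂ)‖ < 1 := by rw [norm_neg, Complex.norm_of_nonneg hr.1.le]; exact hr.2
    have s1 := (hasSum_nat_add_iff' 1).2 (hE.hasSum hα1 hr1)
    have s2 := (hG.hasSum hα2 hr1).mul_left (r : ℂ)
    have h : HasSum (fun n : ℕ => (-(r : ℂ)) ^ (n + 1) * cotTerm α n)
        (E (-(r : ℂ)) - 1 / α + r * G (-(r : ℂ))) := by
      have e0 : (fun n : ℕ => (-(r : ℂ)) ^ (n + 1) * cotTerm α n) = fun n : ℕ =>
          (-(r : ℂ)) ^ (n + 1) / ((n + 1 : ℕ) + α) + r * ((-(r : ℂ)) ^ n / (n + (1 - α))) := by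
        funext n
        have e1 : α - (n + 1) = -(n + (1 - α)) := by ring
        have e2 : α + (n + 1) = ((n + 1 : ℕ) : ℂ) + α := by push_cast; ring
        rw [cotTerm, e1, e2, one_div_neg_eq_neg_one_div]
        ring
      rw [e0]
      simpa using s1.add s2
    rw [h.tsum_eq]
    ring
  have := tendsto_nhds_unique (hcont.congr' heq) hser
  rw [this, hsum.tsum_eq]
  ring

/-- Odd powers cancel, and `2 / (2n + a) = 1 / (n + a/2)`. -/
theorem add_neg_eq (ha : ∀ n : ℕ, a ≠ -n) (hE : IsLerch a E) (hG : IsLerch (a / 2) G) {z : ℂ}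
    (hz : ‖z‖ < 1) : E z + E (-z) = G (z ^ 2) := by
  have ha2 : ∀ n : ℕ, a / 2 ≠ -n := fun n h => ha (2 * n) (by push_cast; linear_combination 2 * h)
  have h1 := (hE.hasSum ha hz).add (hE.hasSum ha (x := -z) (by simpa using hz))
  have h2 := hG.hasSum ha2 (x := z ^ 2) (by
    rw [norm_pow]; exact pow_lt_one₀ (norm_nonneg z) hz two_ne_zero)
  have h3 := HasSum.even_add_odd (f := fun n : ℕ => z ^ n / (n + a) + (-z) ^ n / (n + a))
    (m := G (z ^ 2)) (m' := 0) (by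
      convert h2 using 1
      funext n
      have h0 : (n : ℂ) + a / 2 ≠ 0 := fun h => ha2 n (by linear_combination h)
      have h0' : 2 * (n : ℂ) + a ≠ 0 := fun h => h0 (by linear_combination h / 2)
      push_cast
      rw [pow_mul, pow_mul, neg_sq]
      field_simp
      ring) (by
      convert hasSum_zero using 1
      funext n
      rw [Odd.neg_pow (odd_two_mul_add_one n)]
      ring)
  rw [add_zero] at h3
  exact h1.unique h3

theorem _root_.cutPlane.I_mul_mem {w : ℂ} (hw : 0 < w.re) : Complex.I * w ∈ cutPlane := by
  rw [cutPlane.mem_iff]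
  right
  simpa using hw.ne'

theorem _root_.cutPlane.neg_I_mul_mem {w : ℂ} (hw : 0 < w.re) : -(Complex.I * w) ∈ cutPlane := by
  rw [cutPlane.mem_iff]
  right
  simpa using hw.ne'

theorem _root_.cutPlane.neg_sq_mem {w : ℂ} (hw : 0 < w.re) : -(w ^ 2) ∈ cutPlane := by
  rw [cutPlane.mem_iff]
  by_cases h : w.im = 0
  · left
    simp [pow_two, h]
    nlinarith
  · right
    simp [pow_two]
    intro h'
    have : 2 * (w.re * w.im) = 0 := by linarith
    simp [hw.ne', h] at this

theorem add_neg_I (ha : ∀ n : ℕ, a ≠ -n) (hE : IsLerch a E) (hG : IsLerch (a / 2) G) :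
    E Complex.I + E (-Complex.I) = G (-1) := by
  have h1 : Tendsto (fun r : ℝ => E (Complex.I * r) + E (-(Complex.I * r))) (𝓝[<] 1)
      (𝓝 (E Complex.I + E (-Complex.I))) := by
    have hm1 : Complex.I * ((1 : ℝ) : ℂ) ∈ cutPlane := cutPlane.I_mul_mem (by simp)
    have hm2 : -(Complex.I * ((1 : ℝ) : ℂ)) ∈ cutPlane := cutPlane.neg_I_mul_mem (by simp)
    have h1 : ContinuousAt (fun r : ℝ => E (Complex.I * r)) 1 :=
      ContinuousAt.comp (g := E) (f := fun r : ℝ => Complex.I * (r : ℂ))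
        (hE.analyticAt hm1).continuousAt (by fun_prop)
    have h2 : ContinuousAt (fun r : ℝ => E (-(Complex.I * r))) 1 :=
      ContinuousAt.comp (g := E) (f := fun r : ℝ => -(Complex.I * (r : ℂ)))
        (hE.analyticAt hm2).continuousAt (by fun_prop)
    have h3 : ContinuousAt (fun r : ℝ => E (Complex.I * r) + E (-(Complex.I * r))) 1 := h1.add h2
    simpa using h3.tendsto.mono_left nhdsWithin_le_nhds
  have h2 : Tendsto (fun r : ℝ => G (-(r : ℂ) ^ 2)) (𝓝[<] 1) (𝓝 (G (-1))) := by
    have h : ContinuousAt (fun r : ℝ => G (-(r : ℂ) ^ 2)) 1 :=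
      ContinuousAt.comp (g := G) (f := fun r : ℝ => -(r : ℂ) ^ 2)
        (hG.analyticAt (by simpa using cutPlane.neg_ofReal_mem zero_le_one)).continuousAt
        (by fun_prop)
    simpa using h.tendsto.mono_left nhdsWithin_le_nhds
  refine tendsto_nhds_unique (h1.congr' ?_) h2
  filter_upwards [Ioo_mem_nhdsLT zero_lt_one] with r hr
  rw [add_neg_eq ha hE hG (by simpa [abs_of_pos hr.1] using hr.2), mul_pow, Complex.I_sq,
    neg_one_mul]

/-- The inversion formula, on the two half planes bounded by the real axis. -/
theorem inversion (ha : ∀ n : ℤ, a ≠ 2 * n) (ha' : ∀ n : ℕ, a ≠ -n) (hE : IsLerch a E)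
    (hG : IsLerch (1 - a / 2) G) {w : ℂ} (hw : 0 < w.re) :
    E (Complex.I * w) + E (-(Complex.I * w)) + w⁻¹ ^ 2 * G (-(w⁻¹ ^ 2)) =
      Real.pi / Complex.sin (Real.pi * (a / 2)) * w ^ (-a) := by
  have hα : ∀ n : ℤ, a / 2 ≠ n := fun n h => ha n (by linear_combination 2 * h)
  obtain ⟨B, hB⟩ := exists_of_ne (a := a / 2) fun n h => hα (-n) (by simpa using h)
  have hne : ∀ {w : ℂ}, 0 < w.re → w ≠ 0 := by rintro w h rfl; simp at h
  have hinv : ∀ {w : ℂ}, 0 < w.re → 0 < (w⁻¹).re := fun {w} h => by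
    rw [Complex.inv_re]
    exact div_pos h (Complex.normSq_pos.2 (hne h))
  -- Shown to be constant on the right half plane. There `±i w` stays off the real axis and `-w⁻²`
  -- stays in the cut plane.
  let f : ℂ → ℂ := fun w => w ^ a *
    (E (Complex.I * w) + E (-(Complex.I * w)) + w⁻¹ ^ 2 * G (-(w⁻¹ ^ 2)))
  have hder : ∀ w : ℂ, 0 < w.re → HasDerivAt f 0 w := by
    intro w hw
    have hw0 := hne hw
    have m1 := cutPlane.I_mul_mem hw
    have m2 := cutPlane.neg_I_mul_mem hw
    have m3 := cutPlane.neg_sq_mem (hinv hw)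
    have d0 : HasDerivAt (fun w : ℂ => w ^ a) (a * w ^ (a - 1) * 1) w :=
      (hasDerivAt_id w).cpow_const (Or.inl hw)
    have l1 : HasDerivAt (fun w : ℂ => Complex.I * w) (Complex.I * 1) w :=
      (hasDerivAt_id w).const_mul _
    have d1 : HasDerivAt (fun w => E (Complex.I * w)) _ w := (hE.hasDerivAt m1).comp w l1
    have d2 : HasDerivAt (fun w => E (-(Complex.I * w))) _ w := (hE.hasDerivAt m2).comp w l1.neg
    have l3 : HasDerivAt (fun w : ℂ => w⁻¹ ^ 2) ((2 : ℕ) * w⁻¹ ^ (2 - 1) * -(w ^ 2)⁻¹) w :=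
      (hasDerivAt_inv hw0).pow 2
    have d3 : HasDerivAt (fun w => G (-(w⁻¹ ^ 2))) _ w := (hG.hasDerivAt m3).comp w l3.neg
    have d4 := d0.mul ((d1.add d2).add (l3.mul d3))
    refine d4.congr_deriv ?_
    have o1 := hE.ode _ m1
    have o2 := hE.ode _ m2
    have o3 := hG.ode _ m3
    have n1 := cutPlane.one_sub_ne_zero m1
    have n2 := cutPlane.one_sub_ne_zero m2
    -- The differential equations turn `w f'` into `wᵃ` times the difference of these two sides.
    have hrat : (1 - Complex.I * w)⁻¹ + (1 - -(Complex.I * w))⁻¹ =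
        2 * w⁻¹ ^ 2 * (1 - -(w⁻¹ ^ 2))⁻¹ := by
      have n4 : w ^ 2 + 1 ≠ 0 := by
        have : w ^ 2 + 1 = (1 - Complex.I * w) * (1 - -(Complex.I * w)) := by
          linear_combination w ^ 2 * Complex.I_sq
        rw [this]
        exact mul_ne_zero n1 n2
      have e3 : 2 * w⁻¹ ^ 2 * (1 - -(w⁻¹ ^ 2))⁻¹ = 2 * (w ^ 2 + 1)⁻¹ := by
        have : 1 - -(w⁻¹ ^ 2) = (w ^ 2 + 1) * w⁻¹ ^ 2 := by field_simp; ring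
        rw [this]
        field_simp
      rw [e3]
      field_simp
      linear_combination (2 * w ^ 2) * Complex.I_sq
    have hpow : w ^ a = w ^ (a - 1) * w := by
      rw [Complex.cpow_sub _ _ hw0, Complex.cpow_one]
      field_simp
    have hv : w * w⁻¹ = 1 := mul_inv_cancel₀ hw0
    simp only [Pi.add_apply, Pi.mul_apply]
    generalize deriv E (Complex.I * w) = E₁ at *
    generalize deriv E (-(Complex.I * w)) = E₂ at *
    generalize deriv G (-(w⁻¹ ^ 2)) = G₁ at *
    rw [hpow, ← inv_pow]
    generalize w⁻¹ = v at *
    push_cast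
    linear_combination w ^ (a - 1) * (o1 + o2 + hrat - 2 * v ^ 2 * o3) +
      w ^ (a - 1) * (-2 * v ^ 2 * G (-(v ^ 2)) + 2 * v ^ 4 * G₁) * hv
  have hconst : f w = f 1 := by
    have hc : Convex ℝ {w : ℂ | 0 < w.re} := convex_halfSpace_re_gt 0
    have ho : IsOpen {w : ℂ | 0 < w.re} := isOpen_lt continuous_const Complex.continuous_re
    exact ho.is_const_of_deriv_eq_zero hc.isPreconnected
      (fun w hw => (hder w hw).differentiableAt.differentiableWithinAt)
      (fun w hw => (hder w hw).deriv) hw (by simp)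
  -- At `w = 1` the pair `E(i) + E(-i)` becomes the Lerch function of `a / 2` at `-1`, and
  -- reflection applies.
  have h1 : f 1 = Real.pi / Complex.sin (Real.pi * (a / 2)) := by
    rw [← add_reflect_neg_one hα hB hG, ← add_neg_I ha' hE hB]
    simp [f]
  rw [← h1, ← hconst, Complex.cpow_neg]
  have : w ^ a ≠ 0 := by simp [Complex.cpow_eq_zero_iff, hne hw]
  simp only [f]
  field_simp

end IsLerch

/-! ### Boundary values on the lower side of the cut. -/

namespace IsLerch

variable {a : ℂ} {E G : ℂ → ℂ}

theorem tendsto_below (ha : ∀ n : ℤ, a ≠ 2 * n) (ha' : ∀ n : ℕ, a ≠ -n) (hE : IsLerch a E)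
    (hG : IsLerch (1 - a / 2) G) {y : ℝ} (hy : 0 < y) (hy1 : y < 1) :
    Tendsto (fun ε : ℝ => E (((y⁻¹ : ℝ) : ℂ) - Complex.I * (ε : ℂ))) (𝓝[>] 0)
      (𝓝 ((y : ℂ) ^ 2 * G ((y : ℂ) ^ 2) +
        Real.pi * (y : ℂ) ^ a * (Complex.cot (Real.pi * (a / 2)) - Complex.I) -
          E (-(y : ℂ)⁻¹))) := by
  have hyc : (y : ℂ) ≠ 0 := by exact_mod_cast hy.ne'
  have hα : ∀ n : ℤ, a / 2 ≠ n := fun n h => ha n (by linear_combination 2 * h)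
  have hsin : Complex.sin (Real.pi * (a / 2)) ≠ 0 :=
    sin_pi_mul_ne_zero (Complex.mem_integerComplement_of_ne hα)
  -- Chosen so that `-i w = y⁻¹ - i ε`. At `ε = 0` this is the only argument in the inversion
  -- formula to reach the cut; the other terms are continuous there.
  let w : ℝ → ℂ := fun ε => ε + Complex.I * ((y⁻¹ : ℝ) : ℂ)
  have hw0 : w 0 = Complex.I * ((y⁻¹ : ℝ) : ℂ) := by simp [w]
  have hw : ContinuousAt w 0 := by fun_prop
  have hne : w 0 ≠ 0 := by
    rw [hw0]
    exact mul_ne_zero Complex.I_ne_zero (by exact_mod_cast (inv_pos.2 hy).ne')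
  have hinv : -((w 0)⁻¹ ^ 2) = (y : ℂ) ^ 2 := by
    rw [hw0, mul_inv, mul_pow, Complex.inv_I, neg_sq, Complex.I_sq]
    push_cast
    simp
  have hIw : Complex.I * w 0 = -(y : ℂ)⁻¹ := by
    rw [hw0, ← mul_assoc, Complex.I_mul_I]
    push_cast
    ring
  have hslit : w 0 ∈ Complex.slitPlane := by
    rw [hw0, Complex.mem_slitPlane_iff]
    right
    simpa using hy.ne'
  have c1 : ContinuousAt (fun ε => (w ε) ^ (-a)) 0 := hw.cpow continuousAt_const hslit
  have c2 : ContinuousAt (fun ε => E (Complex.I * w ε)) 0 := by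
    refine ContinuousAt.comp (g := E) (f := fun ε => Complex.I * w ε) ?_ (hw.const_mul _)
    rw [hIw]
    exact (hE.analyticAt (by
      simpa using cutPlane.neg_ofReal_mem (inv_pos.2 hy).le)).continuousAt
  have c3 : ContinuousAt (fun ε => (w ε)⁻¹ ^ 2) 0 := (hw.inv₀ hne).pow 2
  have c4 : ContinuousAt (fun ε => G (-((w ε)⁻¹ ^ 2))) 0 := by
    refine ContinuousAt.comp (g := G) (f := fun ε => -((w ε)⁻¹ ^ 2)) ?_ c3.neg
    rw [hinv]
    refine (hG.analyticAt (cutPlane.ball_subset ?_)).continuousAt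
    rw [mem_ball_zero_iff, norm_pow, Complex.norm_of_nonneg hy.le]
    exact pow_lt_one₀ hy.le hy1 two_ne_zero
  have hcont : ContinuousAt (fun ε => Real.pi / Complex.sin (Real.pi * (a / 2)) * (w ε) ^ (-a) -
      E (Complex.I * w ε) - (w ε)⁻¹ ^ 2 * G (-((w ε)⁻¹ ^ 2))) 0 :=
    ((c1.const_mul _).sub c2).sub (c3.mul c4)
  -- `w 0` has argument `π / 2`, giving the phase `exp(-iπa/2)`; dividing it by `sin(πa/2)` leaves
  -- `cot(πa/2) - i`.
  have hpow : (w 0) ^ (-a) = (y : ℂ) ^ a * (Complex.cos (Real.pi * (a / 2)) -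
      Complex.sin (Real.pi * (a / 2)) * Complex.I) := by
    have e : Complex.cos (Real.pi * (a / 2)) - Complex.sin (Real.pi * (a / 2)) * Complex.I =
        Complex.exp (-(Real.pi * (a / 2)) * Complex.I) := by
      rw [Complex.exp_mul_I, Complex.cos_neg, Complex.sin_neg]
      ring
    rw [e, Complex.cpow_def_of_ne_zero hne, Complex.cpow_def_of_ne_zero hyc, ← Complex.exp_add,
      hw0, Complex.log_mul_ofReal _ (inv_pos.2 hy) _ Complex.I_ne_zero, Complex.log_I,
      Real.log_inv, ← Complex.ofReal_log hy.le]
    congr 1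
    push_cast
    ring
  have hlim := hcont.tendsto.mono_left (nhdsWithin_le_nhds (s := Set.Ioi 0))
  have hval : Real.pi / Complex.sin (Real.pi * (a / 2)) * (w 0) ^ (-a) -
      E (Complex.I * w 0) - (w 0)⁻¹ ^ 2 * G (-((w 0)⁻¹ ^ 2)) =
      (y : ℂ) ^ 2 * G ((y : ℂ) ^ 2) +
        Real.pi * (y : ℂ) ^ a * (Complex.cot (Real.pi * (a / 2)) - Complex.I) -
          E (-(y : ℂ)⁻¹) := by
    have hinv' : (w 0)⁻¹ ^ 2 = -(y : ℂ) ^ 2 := by rw [← hinv, neg_neg]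
    rw [hinv, hinv', hIw, hpow, Complex.cot]
    generalize Complex.sin (Real.pi * (a / 2)) = S at hsin ⊢
    generalize Complex.cos (Real.pi * (a / 2)) = C
    field_simp
    ring
  rw [hval] at hlim
  refine hlim.congr' ?_
  filter_upwards [self_mem_nhdsWithin] with ε hε
  have hre : 0 < (w ε).re := by simpa [w] using hε
  have h := inversion ha ha' hE hG hre
  have e : -(Complex.I * w ε) = ((y⁻¹ : ℝ) : ℂ) - Complex.I * (ε : ℂ) := by
    simp only [w]
    linear_combination (-((y⁻¹ : ℝ) : ℂ)) * Complex.I_sq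
  rw [← e]
  linear_combination -h

end IsLerch

/-! ### The Koebe substitution `z = -4q / (1 - q)²`. -/

/-- The principal square root of `1 - z`. -/
noncomputable def sqrtOneSub (z : ℂ) : ℂ := (1 - z) ^ (2⁻¹ : ℂ)

/-- The inverse on the cut plane of `q ↦ -4 q / (1 - q)²` on the unit disc. -/
noncomputable def koebeInv (z : ℂ) : ℂ := (sqrtOneSub z - 1) / (sqrtOneSub z + 1)

section Koebe

variable {z : ℂ}

theorem sqrtOneSub_sq (z : ℂ) : sqrtOneSub z ^ 2 = 1 - z :=
  Complex.cpow_ofNat_inv_pow (1 - z) 2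

theorem sqrtOneSub_re_pos (hz : z ∈ cutPlane) : 0 < (sqrtOneSub z).re := by
  have h0 := cutPlane.one_sub_ne_zero hz
  have h1 := Complex.neg_pi_lt_arg (1 - z)
  have h2 := lt_of_le_of_ne (Complex.arg_le_pi (1 - z)) (Complex.mem_slitPlane_iff_arg.1 hz).1
  rw [sqrtOneSub, Complex.cpow_def_of_ne_zero h0, Complex.exp_re]
  refine mul_pos (Real.exp_pos _) (Real.cos_pos_of_mem_Ioo ?_)
  have e : (Complex.log (1 - z) * 2⁻¹).im = (1 - z).arg / 2 := by
    have : (2⁻¹ : ℂ) = ((2⁻¹ : ℝ) : ℂ) := by push_cast; rfl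
    rw [this, Complex.im_mul_ofReal, Complex.log_im]
    ring
  rw [e]
  constructor <;> linarith

theorem sqrtOneSub_ne_zero (hz : z ∈ cutPlane) : sqrtOneSub z ≠ 0 := by
  intro h
  have := sqrtOneSub_re_pos hz
  simp [h] at this

theorem sqrtOneSub_add_one_ne_zero (hz : z ∈ cutPlane) : sqrtOneSub z + 1 ≠ 0 := by
  intro h
  have h1 := sqrtOneSub_re_pos hz
  have h2 := congrArg Complex.re h
  simp at h2
  linarith

theorem hasDerivAt_sqrtOneSub (hz : z ∈ cutPlane) :
    HasDerivAt sqrtOneSub (-1 / (2 * sqrtOneSub z)) z := by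
  have h0 := sqrtOneSub_ne_zero hz
  have h : HasDerivAt sqrtOneSub (2⁻¹ * (1 - z) ^ ((2⁻¹ : ℂ) - 1) * -1) z :=
    ((hasDerivAt_id z).const_sub 1).cpow_const hz
  refine h.congr_deriv ?_
  rw [Complex.cpow_sub _ _ (cutPlane.one_sub_ne_zero hz), Complex.cpow_one, ← sqrtOneSub,
    ← sqrtOneSub_sq z]
  field_simp

theorem hasDerivAt_koebeInv (hz : z ∈ cutPlane) :
    HasDerivAt koebeInv (-1 / (sqrtOneSub z * (sqrtOneSub z + 1) ^ 2)) z := by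
  have h0 := sqrtOneSub_ne_zero hz
  have h1 := sqrtOneSub_add_one_ne_zero hz
  have hs := hasDerivAt_sqrtOneSub hz
  refine ((hs.sub_const 1).div (hs.add_const 1) h1).congr_deriv ?_
  field_simp
  ring

theorem mul_deriv_koebeInv (hz : z ∈ cutPlane) :
    z * (-1 / (sqrtOneSub z * (sqrtOneSub z + 1) ^ 2)) = koebeInv z / sqrtOneSub z := by
  have h0 := sqrtOneSub_ne_zero hz
  have h1 := sqrtOneSub_add_one_ne_zero hz
  have h2 := sqrtOneSub_sq z
  rw [koebeInv]
  field_simp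
  linear_combination -h2

/-- The Cayley map `s ↦ (s - 1) / (s + 1)` sends the right half plane into the unit disc. -/
theorem koebeInv_mem_cutPlane (hz : z ∈ cutPlane) : koebeInv z ∈ cutPlane := by
  apply cutPlane.ball_subset
  have h0 := sqrtOneSub_re_pos hz
  have h1 := sqrtOneSub_add_one_ne_zero hz
  rw [mem_ball_zero_iff, koebeInv, norm_div, div_lt_one (norm_pos_iff.2 h1)]
  apply lt_of_pow_lt_pow_left₀ 2 (norm_nonneg _)
  rw [← Complex.normSq_eq_norm_sq, ← Complex.normSq_eq_norm_sq, Complex.normSq_apply,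
    Complex.normSq_apply]
  simp
  nlinarith

theorem one_sub_koebeInv (hz : z ∈ cutPlane) : 1 - koebeInv z = 2 / (sqrtOneSub z + 1) := by
  have h1 := sqrtOneSub_add_one_ne_zero hz
  rw [koebeInv]
  field_simp
  ring

theorem koebeInv_of_real {y : ℝ} (hy : 0 < y) (hy1 : y < 1) :
    koebeInv (-4 / ((y : ℂ) - (y : ℂ)⁻¹) ^ 2) = (y : ℂ) ^ 2 := by
  have h0 : (y : ℂ) ≠ 0 := by exact_mod_cast hy.ne'
  have hp : 0 < 1 - y ^ 2 := by nlinarith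
  have h1 : 1 - (y : ℂ) ^ 2 ≠ 0 := by exact_mod_cast hp.ne'
  have h2 : (y : ℂ) - (y : ℂ)⁻¹ = -(1 - (y : ℂ) ^ 2) / y := by field_simp; ring
  -- `y < 1` selects the sign of the root; for `y > 1` the result would be `y⁻²`.
  have hs : sqrtOneSub (-4 / ((y : ℂ) - (y : ℂ)⁻¹) ^ 2) = (1 + (y : ℂ) ^ 2) / (1 - (y : ℂ) ^ 2) := by
    have e : 1 - -4 / ((y : ℂ) - (y : ℂ)⁻¹) ^ 2 = ((1 + (y : ℂ) ^ 2) / (1 - (y : ℂ) ^ 2)) ^ 2 := by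
      rw [h2]
      field_simp
      ring
    rw [sqrtOneSub, e, Complex.sq_cpow_two_inv]
    have : (1 + (y : ℂ) ^ 2) / (1 - (y : ℂ) ^ 2) = (((1 + y ^ 2) / (1 - y ^ 2) : ℝ) : ℂ) := by
      push_cast; rfl
    rw [this, Complex.ofReal_re]
    positivity
  rw [koebeInv, hs]
  field_simp
  ring

end Koebe

/-! ### The Lerch sum in the Koebe variable and its differential equation. -/

/-- With `A`, `B` the Lerch functions of `1 - κ`, `1 + κ`, the function
`∑ 4 m qᵐ / (m² - κ²)` of `q = koebeInv z`. -/
noncomputable def koebeSum (A B : ℂ → ℂ) (z : ℂ) : ℂ :=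
  2 * koebeInv z * (A (koebeInv z) + B (koebeInv z))

/-- The quotient of `koebeSum A B z` by `z`. -/
noncomputable def koebeQuot (A B : ℂ → ℂ) (z : ℂ) : ℂ :=
  -(1 - koebeInv z) ^ 2 / 2 * (A (koebeInv z) + B (koebeInv z))

theorem koebeSum_comm (A B : ℂ → ℂ) : koebeSum A B = koebeSum B A := by
  funext z
  rw [koebeSum, koebeSum, add_comm]

theorem koebeQuot_comm (A B : ℂ → ℂ) : koebeQuot A B = koebeQuot B A := by
  funext z
  rw [koebeQuot, koebeQuot, add_comm]

theorem mul_koebeQuot (A B : ℂ → ℂ) {z : ℂ} (hz : z ∈ cutPlane) :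
    z * koebeQuot A B z = koebeSum A B z := by
  have h1 := sqrtOneSub_add_one_ne_zero hz
  have h2 := sqrtOneSub_sq z
  have h3 : z * (-(1 - koebeInv z) ^ 2 / 2) = 2 * koebeInv z := by
    rw [one_sub_koebeInv hz, koebeInv]
    field_simp
    linear_combination -h2
  rw [koebeQuot, koebeSum, ← mul_assoc, h3]

namespace IsLerch

variable {κ : ℂ} {A B : ℂ → ℂ} {z : ℂ}

theorem hasDerivAt_comp_koebeInv {a : ℂ} (hA : IsLerch a A) (hz : z ∈ cutPlane) :
    HasDerivAt (fun z => A (koebeInv z))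
      (deriv A (koebeInv z) * (-1 / (sqrtOneSub z * (sqrtOneSub z + 1) ^ 2))) z :=
  (hA.hasDerivAt (koebeInv_mem_cutPlane hz)).comp z (hasDerivAt_koebeInv hz)

theorem analyticOnNhd_of_hasDerivAt {f f' : ℂ → ℂ} (h : ∀ z ∈ cutPlane, HasDerivAt f (f' z) z) :
    AnalyticOnNhd ℂ f cutPlane :=
  DifferentiableOn.analyticOnNhd
    (fun z hz => (h z hz).differentiableAt.differentiableWithinAt) cutPlane.isOpen

theorem analyticOnNhd_koebeInv : AnalyticOnNhd ℂ koebeInv cutPlane :=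
  analyticOnNhd_of_hasDerivAt fun _ hz => hasDerivAt_koebeInv hz

theorem analyticOnNhd_comp_koebeInv {a : ℂ} (hA : IsLerch a A) :
    AnalyticOnNhd ℂ (fun z => A (koebeInv z)) cutPlane :=
  analyticOnNhd_of_hasDerivAt fun _ hz => hA.hasDerivAt_comp_koebeInv hz

theorem analyticOnNhd_koebeSum {a b : ℂ} (hA : IsLerch a A) (hB : IsLerch b B) :
    AnalyticOnNhd ℂ (koebeSum A B) cutPlane :=
  (analyticOnNhd_const.mul analyticOnNhd_koebeInv).mul
    (hA.analyticOnNhd_comp_koebeInv.add hB.analyticOnNhd_comp_koebeInv)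

theorem analyticOnNhd_koebeQuot {a b : ℂ} (hA : IsLerch a A) (hB : IsLerch b B) :
    AnalyticOnNhd ℂ (koebeQuot A B) cutPlane :=
  (((analyticOnNhd_const.sub analyticOnNhd_koebeInv).pow 2).neg.div analyticOnNhd_const
      (fun _ _ => two_ne_zero)).mul
    (hA.analyticOnNhd_comp_koebeInv.add hB.analyticOnNhd_comp_koebeInv)

theorem inv_one_sub_koebeInv (hz : z ∈ cutPlane) :
    koebeInv z * (1 - koebeInv z)⁻¹ = (sqrtOneSub z - 1) / 2 := by
  have h1 := sqrtOneSub_add_one_ne_zero hz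
  rw [one_sub_koebeInv hz, koebeInv]
  field_simp

/-- With `s = sqrtOneSub z`, one has `s · z d/dz = q d/dq`. The operator `q d/dq` sends `q A` to `κ
q A + q / (1 - q)` and `q B` to `-κ q B + q / (1 - q)`. -/
theorem mul_deriv_koebeSum (hA : IsLerch (1 - κ) A) (hB : IsLerch (1 + κ) B)
    (hz : z ∈ cutPlane) :
    z * deriv (koebeSum A B) z =
      (2 * κ * (koebeInv z * (A (koebeInv z) - B (koebeInv z))) + 2 * (sqrtOneSub z - 1)) /
        sqrtOneSub z := by
  have hd : HasDerivAt (koebeSum A B) _ z := ((hasDerivAt_koebeInv hz).const_mul 2).mul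
    ((hA.hasDerivAt_comp_koebeInv hz).add (hB.hasDerivAt_comp_koebeInv hz))
  rw [hd.deriv]
  have hk := mul_deriv_koebeInv hz
  have oA := hA.ode _ (koebeInv_mem_cutPlane hz)
  have oB := hB.ode _ (koebeInv_mem_cutPlane hz)
  have hq := inv_one_sub_koebeInv hz
  have h0 := sqrtOneSub_ne_zero hz
  generalize -1 / (sqrtOneSub z * (sqrtOneSub z + 1) ^ 2) = d at *
  rw [eq_div_iff h0]
  rw [eq_div_iff h0] at hk
  linear_combination (2 * (A (koebeInv z) + B (koebeInv z)) + 2 * koebeInv z *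
    (deriv A (koebeInv z) + deriv B (koebeInv z))) * hk + 2 * koebeInv z * (oA + oB) + 4 * hq

/-- Applying `s · z d/dz` twice gives `κ² V - z`: the `q / (1 - q)` terms cancel in `A - B`, and `2
(s - 1)` contributes `-z`. Expanding with `s² = 1 - z` yields the stated form. -/
theorem ode_koebeSum (hA : IsLerch (1 - κ) A) (hB : IsLerch (1 + κ) B) (hz : z ∈ cutPlane) :
    (1 - z) * (z * deriv (fun z => z * deriv (koebeSum A B) z) z) =
      κ ^ 2 * koebeSum A B z - z + 1 / 2 * (z * (z * deriv (koebeSum A B) z)) := by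
  have heq : (fun z => z * deriv (koebeSum A B) z) =ᶠ[𝓝 z] fun z =>
      (2 * κ * (koebeInv z * (A (koebeInv z) - B (koebeInv z))) + 2 * (sqrtOneSub z - 1)) /
        sqrtOneSub z := by
    filter_upwards [cutPlane.isOpen.mem_nhds hz] with w hw using mul_deriv_koebeSum hA hB hw
  have h0 := sqrtOneSub_ne_zero hz
  have hs := hasDerivAt_sqrtOneSub hz
  have hd : HasDerivAt (fun z =>
      (2 * κ * (koebeInv z * (A (koebeInv z) - B (koebeInv z))) + 2 * (sqrtOneSub z - 1)) /
        sqrtOneSub z) _ z := ((((hasDerivAt_koebeInv hz).mul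
    ((hA.hasDerivAt_comp_koebeInv hz).sub (hB.hasDerivAt_comp_koebeInv hz))).const_mul (2 * κ)).add
      ((hs.sub_const 1).const_mul 2)).div hs h0
  rw [heq.deriv_eq, hd.deriv, mul_deriv_koebeSum hA hB hz, koebeSum, ← sqrtOneSub_sq z]
  have hk := mul_deriv_koebeInv hz
  have oA := hA.ode _ (koebeInv_mem_cutPlane hz)
  have oB := hB.ode _ (koebeInv_mem_cutPlane hz)
  generalize -1 / (sqrtOneSub z * (sqrtOneSub z + 1) ^ 2) = d at *
  simp only [Pi.add_apply, Pi.sub_apply, Pi.mul_apply]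
  rw [eq_div_iff h0] at hk
  field_simp
  linear_combination sqrtOneSub z * (2 * κ * ((A (koebeInv z) - B (koebeInv z)) + koebeInv z *
    (deriv A (koebeInv z) - deriv B (koebeInv z)))) * hk +
      sqrtOneSub z * (2 * κ * koebeInv z) * (oA - oB)

end IsLerch

/-! ### Taylor coefficients and the continuation of `₃F₂`. -/

namespace IsLerch

variable {κ k : ℂ} {A B : ℂ → ℂ}

theorem taylorCoeff_koebeSum_succ (hA : IsLerch (1 - κ) A) (hB : IsLerch (1 + κ) B) (n : ℕ) :
    (((n : ℂ) + 1) ^ 2 - κ ^ 2) * taylorCoeff (koebeSum A B) (n + 1) =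
      n * (n + 1 / 2) * taylorCoeff (koebeSum A B) n - if n = 0 then 1 else 0 := by
  set V := koebeSum A B with hV
  have hVa : AnalyticAt ℂ V 0 := hA.analyticOnNhd_koebeSum hB 0 cutPlane.zero_mem
  set X : ℂ → ℂ := fun z => z * deriv V z with hX
  have hXa : AnalyticAt ℂ X 0 := analyticAt_id.mul hVa.deriv
  set Y : ℂ → ℂ := fun z => z * deriv X z with hY
  have hYa : AnalyticAt ℂ Y 0 := analyticAt_id.mul hXa.deriv
  have hzY : AnalyticAt ℂ (fun z => z * Y z) 0 := analyticAt_id.mul hYa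
  have hzX : AnalyticAt ℂ (fun z => z * X z) 0 := analyticAt_id.mul hXa
  have hz1 : AnalyticAt ℂ (fun z : ℂ => z * 1) 0 := analyticAt_id.mul analyticAt_const
  have hκV : AnalyticAt ℂ (fun z => κ ^ 2 * V z) 0 := analyticAt_const.mul hVa
  have hκz : AnalyticAt ℂ (fun z => κ ^ 2 * V z - z * 1) 0 := hκV.sub hz1
  have hcX : AnalyticAt ℂ (fun z => 1 / 2 * (z * X z)) 0 := analyticAt_const.mul hzX
  have h1 : taylorCoeff (fun z => Y z - z * Y z) (n + 1) =
      taylorCoeff (fun z => (κ ^ 2 * V z - z * 1) + 1 / 2 * (z * X z)) (n + 1) := by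
    apply taylorCoeff.congr
    filter_upwards [cutPlane.mem_nhds_zero] with z hz
    linear_combination hA.ode_koebeSum hB hz
  rw [taylorCoeff.sub hYa hzY, taylorCoeff.add hκz hcX, taylorCoeff.sub hκV hz1,
    taylorCoeff.const_mul, taylorCoeff.const_mul, taylorCoeff.id_mul_succ hYa,
    taylorCoeff.id_mul_succ hXa, taylorCoeff.id_mul_succ analyticAt_const, taylorCoeff.const,
    taylorCoeff.id_mul_deriv hXa, taylorCoeff.id_mul_deriv hXa, taylorCoeff.id_mul_deriv hVa,
    taylorCoeff.id_mul_deriv hVa] at h1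
  push_cast at h1
  linear_combination h1

/-- The analytic continuation of `₃F₂(1/2, 1, 1; -k/2, 2 + k/2; z)` to the cut plane. -/
noncomputable def _root_.hyp3F2Continuation (k : ℂ) (A B : ℂ → ℂ) (z : ℂ) : ℂ :=
  -(k + 2) * (1 / 2 * koebeQuot A B z + -1 / k +
    1 / (2 * k) * (z * deriv (koebeSum A B) z + -2 * deriv (koebeSum A B) z))

theorem analyticOnNhd_hyp3F2Continuation (hA : IsLerch (1 - k / 2) A)
    (hB : IsLerch (1 + k / 2) B) : AnalyticOnNhd ℂ (hyp3F2Continuation k A B) cutPlane := by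
  have hV := (hA.analyticOnNhd_koebeSum hB).deriv
  exact analyticOnNhd_const.mul
    (((analyticOnNhd_const.mul (hA.analyticOnNhd_koebeQuot hB)).add analyticOnNhd_const).add
      (analyticOnNhd_const.mul ((analyticOnNhd_id.mul hV).add (analyticOnNhd_const.mul hV))))

theorem taylorCoeff_koebeQuot {a b : ℂ} (hA : IsLerch a A) (hB : IsLerch b B) (n : ℕ) :
    taylorCoeff (koebeQuot A B) n = taylorCoeff (koebeSum A B) (n + 1) := by
  rw [← taylorCoeff.id_mul_succ (hA.analyticOnNhd_koebeQuot hB 0 cutPlane.zero_mem)]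
  apply taylorCoeff.congr
  filter_upwards [cutPlane.mem_nhds_zero] with z hz using mul_koebeQuot A B hz

/-- This explains the combination in `hyp3F2Continuation`: once the recurrence eliminates the `n`-th
coefficient of `V`, the factor multiplying the `(n + 1)`-st one splits into linear factors in `n`.
Apart from the prefactor `-(k + 2)`, its first term is even in `k` and the rest odd. -/
theorem taylorCoeff_hyp3F2Continuation (hk : k ≠ 0) (hA : IsLerch (1 - k / 2) A)
    (hB : IsLerch (1 + k / 2) B) (n : ℕ) :
    k * (2 * n + 1) * taylorCoeff (hyp3F2Continuation k A B) n =
      (k + 2) * (n + 1 - k / 2) * (n - k / 2) * taylorCoeff (koebeSum A B) (n + 1) := by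
  have hrec := hA.taylorCoeff_koebeSum_succ hB n
  have hVa := hA.analyticOnNhd_koebeSum hB 0 cutPlane.zero_mem
  have hWa := hA.analyticOnNhd_koebeQuot hB 0 cutPlane.zero_mem
  have h1 : AnalyticAt ℂ (fun z => 1 / 2 * koebeQuot A B z) 0 := analyticAt_const.mul hWa
  have h2 : AnalyticAt ℂ (fun z => z * deriv (koebeSum A B) z) 0 := analyticAt_id.mul hVa.deriv
  have h3 : AnalyticAt ℂ (fun z => -2 * deriv (koebeSum A B) z) 0 :=
    analyticAt_const.mul hVa.deriv
  have h4 : AnalyticAt ℂ (fun z => 1 / 2 * koebeQuot A B z + -1 / k) 0 :=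
    h1.add analyticAt_const
  have h5 : AnalyticAt ℂ (fun z => 1 / (2 * k) * (z * deriv (koebeSum A B) z +
      -2 * deriv (koebeSum A B) z)) 0 := analyticAt_const.mul (h2.add h3)
  have h6 : taylorCoeff (hyp3F2Continuation k A B) n = taylorCoeff (fun z => -(k + 2) *
      (1 / 2 * koebeQuot A B z + -1 / k + 1 / (2 * k) * (z * deriv (koebeSum A B) z +
        -2 * deriv (koebeSum A B) z))) n := rfl
  rw [h6, taylorCoeff.const_mul, taylorCoeff.add h4 h5, taylorCoeff.add h1 analyticAt_const,
    taylorCoeff.const, taylorCoeff.const_mul, taylorCoeff.const_mul, taylorCoeff.add h2 h3,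
    taylorCoeff.const_mul, taylorCoeff.id_mul_deriv hVa, taylorCoeff.deriv_eq,
    hA.taylorCoeff_koebeQuot hB]
  -- For `n = 0` the constant `-1 / k` compensates the inhomogeneous term of the recurrence.
  rcases eq_or_ne n 0 with rfl | hn
  · simp only [if_true] at hrec ⊢
    push_cast at hrec ⊢
    field_simp
    linear_combination (4 * (k + 2)) * hrec
  · simp only [hn, if_false] at hrec ⊢
    field_simp
    linear_combination (4 * (k + 2)) * hrec

theorem taylorCoeff_hyp3F2Continuation_eq (hk : ∀ n : ℤ, k ≠ 2 * n)
    (hA : IsLerch (1 - k / 2) A) (hB : IsLerch (1 + k / 2) B) (n : ℕ) :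
    taylorCoeff (hyp3F2Continuation k A B) n =
      (ascPochhammer ℂ n).eval (1 / 2) * (ascPochhammer ℂ n).eval 1 * (ascPochhammer ℂ n).eval 1 /
        ((ascPochhammer ℂ n).eval (-k / 2) * (ascPochhammer ℂ n).eval (2 + k / 2)) /
          (n.factorial : ℂ) := by
  have hk0 : k ≠ 0 := by simpa using hk 0
  have hne : ∀ m : ℤ, (m : ℂ) - k / 2 ≠ 0 := fun m h => hk m (by linear_combination -2 * h)
  have hne' : ∀ m : ℤ, (m : ℂ) + k / 2 ≠ 0 := fun m h =>
    hk (-m) (by push_cast; linear_combination 2 * h)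
  induction n with
  | zero =>
    have h := hA.taylorCoeff_hyp3F2Continuation hk0 hB 0
    have hrec := hA.taylorCoeff_koebeSum_succ hB 0
    simp only [if_true] at hrec
    push_cast at h hrec
    simp only [ascPochhammer_zero, Polynomial.eval_one, Nat.factorial_zero, Nat.cast_one]
    norm_num
    apply mul_left_cancel₀ hk0
    linear_combination h - k * hrec
  | succ n ih =>
    have h0 := hA.taylorCoeff_hyp3F2Continuation hk0 hB n
    have h1 := hA.taylorCoeff_hyp3F2Continuation hk0 hB (n + 1)
    have hrec := hA.taylorCoeff_koebeSum_succ hB (n + 1)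
    simp only [Nat.succ_ne_zero, if_false, sub_zero] at hrec
    push_cast at h0 h1 hrec
    have n1 := hne n
    have n2 := hne' (n + 2)
    push_cast at n1 n2
    have n3 : 2 * (n : ℂ) + 3 ≠ 0 := by exact_mod_cast (by omega : 2 * n + 3 ≠ 0)
    -- The ratio of consecutive `₃F₂` coefficients: one `(1)ₙ` cancels `n!`, the other gives the
    -- factor `n + 1`.
    have key : (n - k / 2) * (n + 2 + k / 2) * taylorCoeff (hyp3F2Continuation k A B) (n + 1) =
        (n + 1) * (n + 1 / 2) * taylorCoeff (hyp3F2Continuation k A B) n := by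
      apply mul_left_cancel₀ (mul_ne_zero hk0 n3)
      linear_combination (n - k / 2) * (n + 2 + k / 2) * h1 +
        (k + 2) * (n + 1 - k / 2) * (n - k / 2) * hrec - (n + 1) * (n + 3 / 2) * h0
    have h5 := ascPochhammer_eval_ne_zero (a := -k / 2)
      (fun m h => hne m (by linear_combination h)) n
    have h6 := ascPochhammer_eval_ne_zero (a := 2 + k / 2)
      (fun m h => hne' (2 + m) (by push_cast; linear_combination h)) n
    have h7 : ((n.factorial : ℕ) : ℂ) ≠ 0 := by exact_mod_cast n.factorial_ne_zero
    have h8 : (n : ℂ) + 1 ≠ 0 := by exact_mod_cast n.succ_ne_zero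
    have n1' : -k / 2 + n ≠ 0 := by convert n1 using 1; ring
    have n2' : 2 + k / 2 + n ≠ 0 := by convert n2 using 1; ring
    apply mul_left_cancel₀ (mul_ne_zero n1 n2)
    rw [key, ih]
    simp only [ascPochhammer_succ_eval, Nat.factorial_succ]
    push_cast
    generalize (ascPochhammer ℂ n).eval (-k / 2) = p at *
    generalize (ascPochhammer ℂ n).eval (2 + k / 2) = q at *
    rw [show (n : ℂ) - k / 2 = -k / 2 + n by ring,
      show (n : ℂ) + 2 + k / 2 = 2 + k / 2 + n by ring]
    generalize -k / 2 + (n : ℂ) = u at *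
    generalize 2 + k / 2 + (n : ℂ) = v at *
    field_simp
    ring

theorem hyp3F2_eq (hk : ∀ n : ℤ, k ≠ 2 * n) (hA : IsLerch (1 - k / 2) A)
    (hB : IsLerch (1 + k / 2) B) {z : ℂ} (hz : z ∈ cutPlane) :
    hyp3F2 (1 / 2) 1 1 (-k / 2) (2 + k / 2) z = hyp3F2Continuation k A B z := by
  have ha := hA.analyticOnNhd_hyp3F2Continuation hB
  refine principalBranch_of_mem_cutPlane ha ?_ hz
  filter_upwards [taylorCoeff.eventually_hasSum (ha 0 cutPlane.zero_mem)] with w hw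
  rw [← hw.tsum_eq, hyp3F2Series]
  congr 1
  funext n
  rw [hA.taylorCoeff_hyp3F2Continuation_eq hk hB]
  ring

end IsLerch

/-! ### Evaluation of both sides at `q = y²`. -/

section Evaluation

variable {k : ℂ} {y : ℝ} {A B : ℂ → ℂ}

theorem neg_four_div_sq_mem_cutPlane (y : ℝ) :
    -4 / ((y : ℂ) - (y : ℂ)⁻¹) ^ 2 ∈ cutPlane := by
  have e : -4 / ((y : ℂ) - (y : ℂ)⁻¹) ^ 2 = -((4 / (y - y⁻¹) ^ 2 : ℝ) : ℂ) := by
    push_cast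
    ring
  rw [e]
  exact cutPlane.neg_ofReal_mem (by positivity)

theorem threeFTwoTerm_add_neg (hk : ∀ n : ℤ, k ≠ 2 * n) (hA : IsLerch (1 - k / 2) A)
    (hB : IsLerch (1 + k / 2) B) (hy : 0 < y) (hy1 : y < 1) :
    threeFTwoTerm k (y : ℂ) + threeFTwoTerm (-k) (y : ℂ) =
      2 * (y : ℂ) ^ 2 * (A ((y : ℂ) ^ 2) + B ((y : ℂ) ^ 2)) := by
  have hz := neg_four_div_sq_mem_cutPlane y
  have hk0 : k ≠ 0 := by simpa using hk 0
  have h2 : k + 2 ≠ 0 := fun h => hk (-1) (by push_cast; linear_combination h)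
  have h2' : -k + 2 ≠ 0 := fun h => hk 1 (by push_cast; linear_combination -h)
  have hk' : ∀ n : ℤ, -k ≠ 2 * n := fun n h => hk (-n) (by push_cast; linear_combination -h)
  have hA' : IsLerch (1 + -k / 2) A := by convert hA using 1; ring
  have hB' : IsLerch (1 - -k / 2) B := by convert hB using 1; ring
  have hy0 : (y : ℂ) ≠ 0 := by exact_mod_cast hy.ne'
  have hsub : (y : ℂ) - (y : ℂ)⁻¹ ≠ 0 := by
    have : y < y⁻¹ := hy1.trans ((one_lt_inv₀ hy).2 hy1)
    exact_mod_cast (sub_neg.2 this).ne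
  have hW := mul_koebeQuot A B hz
  rw [koebeSum, koebeInv_of_real hy hy1] at hW
  -- Replacing `k` by `-k` swaps `A` and `B`, which leaves the sum and its quotient by `z`
  -- unchanged; only the two halves of that quotient survive the addition.
  rw [← hW, threeFTwoTerm, threeFTwoTerm, hA.hyp3F2_eq hk hB hz, hB'.hyp3F2_eq hk' hA' hz,
    hyp3F2Continuation, hyp3F2Continuation, koebeSum_comm B A, koebeQuot_comm B A]
  field_simp
  ring

theorem hyp2F1_one_add_neg (hk' : ∀ n : ℕ, k ≠ -n)
    {G : ℂ → ℂ} (hG : IsLerch (k / 2) G) (hy : 0 < y) (hy1 : y < 1) :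
    hyp2F1 1 k (k + 1) (y : ℂ) + hyp2F1 1 k (k + 1) (-(y : ℂ)) = k * G ((y : ℂ) ^ 2) := by
  obtain ⟨E, hE⟩ := IsLerch.exists_of_ne hk'
  have hn : ‖(y : ℂ)‖ < 1 := by rwa [Complex.norm_of_nonneg hy.le]
  have m1 : (y : ℂ) ∈ cutPlane := cutPlane.ball_subset (by simpa using hn)
  rw [hE.hyp2F1_of_mem hk' m1, hE.hyp2F1_of_mem hk' (cutPlane.neg_ofReal_mem hy.le),
    ← hE.add_neg_eq hk' hG hn]
  ring

theorem hyp2F1_inv_add_neg_inv (hk : ∀ n : ℤ, k ≠ 2 * n) (hk' : ∀ n : ℕ, k ≠ -n)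
    (hA : IsLerch (1 - k / 2) A) (hy : 0 < y) (hy1 : y < 1) :
    hyp2F1 1 k (k + 1) (y : ℂ)⁻¹ + hyp2F1 1 k (k + 1) (-(y : ℂ)⁻¹) =
      k * ((y : ℂ) ^ 2 * A ((y : ℂ) ^ 2) +
        Real.pi * (y : ℂ) ^ k * (Complex.cot (Real.pi * (k / 2)) - Complex.I)) := by
  obtain ⟨E, hE⟩ := IsLerch.exists_of_ne hk'
  have h1 := hE.hyp2F1_of_one_le hk' ((one_lt_inv₀ hy).2 hy1).le
    (hE.tendsto_below hk hk' hA hy hy1)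
  have m2 : -(y : ℂ)⁻¹ ∈ cutPlane := by simpa using cutPlane.neg_ofReal_mem (inv_pos.2 hy).le
  rw [Complex.ofReal_inv] at h1
  rw [h1, hE.hyp2F1_of_mem hk' m2]
  ring

theorem Complex.cot_add_pi (x : ℂ) : Complex.cot (x + Real.pi) = Complex.cot x := by
  rw [Complex.cot, Complex.cot, Complex.cos_add_pi, Complex.sin_add_pi, neg_div_neg_eq]

theorem twoFOneTerm_add_inv (hre : -1 < k.re) (hk : ∀ n : ℤ, k ≠ 2 * n)
    (hA : IsLerch (1 - k / 2) A) (hB : IsLerch (1 + k / 2) B) (hy : 0 < y) (hy1 : y < 1) :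
    twoFOneTerm k (y : ℂ) + twoFOneTerm k ((y : ℂ)⁻¹) =
      2 * (y : ℂ) ^ 2 * (A ((y : ℂ) ^ 2) + B ((y : ℂ) ^ 2)) +
        2 * Real.pi * (y : ℂ) ^ k * (Complex.cot (Real.pi * (k / 2)) - Complex.I) := by
  have hk0 : k ≠ 0 := by simpa using hk 0
  have hk2 : ∀ n : ℤ, k + 2 ≠ 2 * n := fun n h =>
    hk (n - 1) (by push_cast; linear_combination h)
  have h2 : k + 2 ≠ 0 := by simpa using hk2 0
  -- The bound on the real part excludes the negative integers, odd ones included, so that the Lerch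
  -- function of parameter `k` exists.
  have hn : ∀ n : ℕ, k ≠ -n := by
    rintro (_ | n) h
    · exact hk0 (by simpa using h)
    · have := congrArg Complex.re h
      simp at this
      linarith
  have hn2 : ∀ n : ℕ, k + 2 ≠ -n := fun n h =>
    hn (n + 2) (by push_cast; linear_combination h)
  have hm : (y : ℂ) ^ 2 ∈ cutPlane := cutPlane.ball_subset (by
    rw [mem_ball_zero_iff, norm_pow, Complex.norm_of_nonneg hy.le]
    exact pow_lt_one₀ hy.le hy1 two_ne_zero)
  obtain ⟨C, hC⟩ := IsLerch.exists_of_ne (a := 1 - (k + 2) / 2) fun n h =>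
    hk n (by push_cast; linear_combination -2 * h)
  -- Inversion at parameter `k + 2` involves parameter `-k/2`, one step below that of `A`; the
  -- resulting `-2 / k` cancels against the `2 / k` from `hG`.
  have hCA : C ((y : ℂ) ^ 2) = 1 / (-(k / 2)) + (y : ℂ) ^ 2 * A ((y : ℂ) ^ 2) := by
    have h0 : -(k / 2) ≠ 0 := by simpa using hk0
    have hA' : IsLerch (-(k / 2) + 1) A := by convert hA using 1; ring
    have hC' : IsLerch (-(k / 2)) C := by convert hC using 1; ring
    exact hC'.eqOn (hA'.of_succ h0) (fun n h => hk n (by push_cast; linear_combination -2 * h)) hm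
  have hG := (show IsLerch (k / 2 + 1) B by convert hB using 1; ring).of_succ
    (a := k / 2) (by simpa using hk0)
  have hB2 : IsLerch ((k + 2) / 2) B := by convert hB using 1; ring
  have e3 : k + 3 = k + 2 + 1 := by ring
  have f1 := hyp2F1_inv_add_neg_inv hk hn hA hy hy1
  have f2 := hyp2F1_inv_add_neg_inv hk2 hn2 hC hy hy1
  have f3 := hyp2F1_one_add_neg hn hG hy hy1
  have f4 := hyp2F1_one_add_neg hn2 hB2 hy hy1
  have hy0 : (y : ℂ) ≠ 0 := by exact_mod_cast hy.ne'
  have hp : 0 < 1 - y ^ 2 := by nlinarith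
  have hsub : 1 - (y : ℂ) ^ 2 ≠ 0 := by exact_mod_cast hp.ne'
  have hcot : Complex.cot (Real.pi * ((k + 2) / 2)) = Complex.cot (Real.pi * (k / 2)) := by
    rw [← Complex.cot_add_pi (Real.pi * (k / 2))]
    congr 1
    ring
  have hpow : (y : ℂ) ^ (k + 2) = (y : ℂ) ^ k * (y : ℂ) ^ 2 := by
    rw [Complex.cpow_add _ _ hy0, Complex.cpow_ofNat]
  have d1 : (y : ℂ)⁻¹ - y = (1 - (y : ℂ) ^ 2) / y := by field_simp
  have d2 : (y : ℂ) - (y : ℂ)⁻¹ = -((1 - (y : ℂ) ^ 2) / y) := by field_simp; ring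
  -- The prefactors are `2 / (1 - y²)` and `-2y² / (1 - y²)`. Since `cot` has period `π`, passing
  -- from `k` to `k + 2` only multiplies the cut contribution by `y²`, and the common factor `1 -
  -- y²` cancels.
  rw [twoFOneTerm, twoFOneTerm, inv_inv, e3, f1, f2, f3, f4, hcot, hpow, hCA, d1, d2]
  field_simp
  ring

theorem connection_of_lt_one (hre : -1 < k.re) (hk : ∀ n : ℤ, k ≠ 2 * n) (hy : 0 < y)
    (hy1 : y < 1) :
    threeFTwoTerm k (y : ℂ) + threeFTwoTerm (-k) (y : ℂ) =
      2 * (Real.pi : ℂ) * (y : ℂ) ^ k * (Complex.I - Complex.cot ((Real.pi : ℂ) * k / 2)) +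
        (twoFOneTerm k (y : ℂ) + twoFOneTerm k ((y : ℂ)⁻¹)) := by
  obtain ⟨A, hA⟩ := IsLerch.exists_of_ne (a := 1 - k / 2) fun n h =>
    hk (n + 1) (by push_cast; linear_combination -2 * h)
  obtain ⟨B, hB⟩ := IsLerch.exists_of_ne (a := 1 + k / 2) fun n h =>
    hk (-n - 1) (by push_cast; linear_combination 2 * h)
  rw [threeFTwoTerm_add_neg hk hA hB hy hy1, twoFOneTerm_add_inv hre hk hA hB hy hy1,
    mul_div_assoc]
  ring

theorem threeFTwoTerm_inv (k y : ℂ) : threeFTwoTerm k y⁻¹ = threeFTwoTerm k y := by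
  have e : (y⁻¹ - y⁻¹⁻¹) ^ 2 = (y - y⁻¹) ^ 2 := by rw [inv_inv]; ring
  rw [threeFTwoTerm, threeFTwoTerm, e]

end Evaluation

theorem mainTheorem8 (k : ℂ) (hk : -1 < k.re) (hk_even : ∀ m : ℕ, k ≠ 2 * (m : ℂ))
    (y : ℝ) (hy : 0 < y) (hy_one : y ≠ 1) :
    threeFTwoTerm k (y : ℂ) + threeFTwoTerm (-k) (y : ℂ) =
      2 * (Real.pi : ℂ) * ((min y y⁻¹ : ℝ) : ℂ) ^ k *
          (Complex.I - Complex.cot ((Real.pi : ℂ) * k / 2)) +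
        (twoFOneTerm k (y : ℂ) + twoFOneTerm k ((y : ℂ)⁻¹)) := by
  have hk_int : ∀ n : ℤ, k ≠ 2 * n := by
    rintro (n | n) h
    · exact hk_even n (by simpa using h)
    · have := congrArg Complex.re h
      simp at this
      have hn : (0 : ℝ) ≤ n := n.cast_nonneg
      linarith
  rcases lt_or_gt_of_ne hy_one with h | h
  · rw [min_eq_left (h.trans ((one_lt_inv₀ hy).2 h)).le]
    exact connection_of_lt_one hk hk_int hy h
  · have hinv : y⁻¹ < 1 := inv_lt_one_of_one_lt₀ h
    rw [min_eq_right (hinv.trans h).le]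
    have := connection_of_lt_one hk hk_int (inv_pos.2 hy) hinv
    rw [Complex.ofReal_inv, inv_inv, threeFTwoTerm_inv, threeFTwoTerm_inv] at this
    rw [this, Complex.ofReal_inv, add_comm (twoFOneTerm k _)]
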